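/- Let $p,q\ge 0$, $n=p+q$ and $\eta=\mathrm{diag}(1,\dots,1,-1,\dots,-1)$ ($p$ entries $1$, $q$ entries $-1$). Let $C\ell_{p,q}$ be the real Clifford algebra with identity $e$ and generators $e_1,\dots,e_n$, $e_ae_b+e_be_a=2\eta_{ab}e$, let $V=\mathrm{span}(e_1,\dots,e_n)$ be its subspace of vectors and $C\ell^{(0)}_{p,q}$ its even part; write $\widehat U$ for the grade involution and $\widetilde U$ for the reversion of $U$. Let $\Gamma^{\pm}_{p,q}$ be the Lipschitz group of all invertible $T\in C\ell_{p,q}$ with $\widehat T xT^{-1}\in V$ for all $x\in V$, and let $\Gamma^+_{p,q}$ be the group of all invertible $T\in C\ell^{(0)}_{p,q}$ with $TxT^{-1}\in V$ for all $x\in V$. Define the groups $$\mathrm{Pin}(p,q)=\{T\in\Gamma^\pm_{p,q}:\widetilde TT=\pm e\},\quad \mathrm{Pin}_+(p,q)=\{T\in\Gamma^\pm_{p,q}:\widehat{\widetilde T}T=e\},\quad \mathrm{Pin}_-(p,q)=\{T\in\Gamma^\pm_{p,q}:\widetilde TT=e\},$$ $$\mathrm{Spin}(p,q)=\{T\in\Gamma^+_{p,q}:\widetilde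 TT=\pm e\},\quad \mathrm{Spin}_+(p,q)=\{T\in\Gamma^+_{p,q}:\widetilde TT=e\}.$$ Let $\mathrm O(p,q)=\{A\in\mathrm{Mat}(n,\mathbb R):A^{\mathsf T}\eta A=\eta\}$, $\mathrm{SO}(p,q)=\{A\in\mathrm O(p,q):\det A=1\}$; let $\mathrm O_+(p,q)$ (resp. $\mathrm O_-(p,q)$) be the group of all $A\in\mathrm O(p,q)$ whose minor with rows and columns $1,\dots,p$ (resp. $p+1,\dots,n$) is $\ge 1$, an empty minor being $1$, and $\mathrm{SO}_+(p,q)=\mathrm{SO}(p,q)\cap\mathrm O_+(p,q)$. For $T$ in any of the five groups in $C\ell_{p,q}$ above, the twisted adjoint map $\widetilde{\mathrm{Ad}}_T(x)=\widehat TxT^{-1}$ maps $V$ to $V$; identify it with its matrix $P=\|p^b_a\|$ in the basis $e_1,\dots,e_n$, that is $\widehat Te_aT^{-1}=\sum_b p^b_a e_b$ with $b$ the row index and $a$ the column index. Then $T\mapsto\widetilde{\mathrm{Ad}}_T$ defines surjective group homomorphisms, each with kernel $\{e,-e\}$: $$\mathrm{Pin}(p,q)\to\mathrm O(p,q),\quad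 \mathrm{Spin}(p,q)\to\mathrm{SO}(p,q),\quad \mathrm{Spin}_+(p,q)\to\mathrm{SO}_+(p,q),$$ $$\mathrm{Pin}_+(p,q)\to\mathrm O_+(p,q),\quad \mathrm{Pin}_-(p,q)\to\mathrm O_-(p,q).$$ -/

import Mathlib

open scoped Matrix

noncomputable section

namespace SpinCover

/-! ### Pseudo-orthogonal groups -/

/-- The index set `{1, …, n}`, `n = p + q`: `Sum.inl` lists `1, …, p` and `Sum.inr` lists
`p + 1, …, n`. -/
abbrev Idx (p q : ℕ) : Type := Fin p ⊕ Fin q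

/-- The diagonal entries of `η`: `p` times `1`, then `q` times `-1`. -/
def sgn (p q : ℕ) : Idx p q → ℝ := Sum.elim (fun _ => 1) (fun _ => -1)

/-- The matrix `η = diag(1, …, 1, -1, …, -1)`. -/
def eta (p q : ℕ) : Matrix (Idx p q) (Idx p q) ℝ := Matrix.diagonal (sgn p q)

lemma eta_mul_eta (p q : ℕ) : eta p q * eta p q = 1 := by
  rw [eta, Matrix.diagonal_mul_diagonal, ← Matrix.diagonal_one]
  congr 1
  funext i
  rcases i with i | i <;> simp [sgn]

/-- `O(p,q) = {A | Aᵀ η A = η}`. -/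
def O (p q : ℕ) : Subgroup (GL (Idx p q) ℝ) where
  carrier := {A | (A : Matrix (Idx p q) (Idx p q) ℝ)ᵀ * eta p q * A = eta p q}
  one_mem' := by simp
  mul_mem' := by
    intro A B hA hB
    simp only [Set.mem_ofPred_eq, Units.val_mul, Matrix.transpose_mul] at *
    calc _ = (B : Matrix (Idx p q) (Idx p q) ℝ)ᵀ *
          ((A : Matrix (Idx p q) (Idx p q) ℝ)ᵀ * eta p q * A) * B := by
            simp only [Matrix.mul_assoc]
      _ = eta p q := by rw [hA, hB]
  inv_mem' := by
    intro A hA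
    simp only [Set.mem_ofPred_eq] at *
    have h : (A : Matrix (Idx p q) (Idx p q) ℝ) * (A⁻¹ : GL (Idx p q) ℝ) = 1 := by
      rw [← Units.val_mul]; simp
    have h' : ((A⁻¹ : GL (Idx p q) ℝ) : Matrix (Idx p q) (Idx p q) ℝ)ᵀ *
        (A : Matrix (Idx p q) (Idx p q) ℝ)ᵀ = 1 := by
      rw [← Matrix.transpose_mul, h, Matrix.transpose_one]
    generalize ((A⁻¹ : GL (Idx p q) ℝ) : Matrix (Idx p q) (Idx p q) ℝ) = B at *
    calc Bᵀ * eta p q * B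
        = Bᵀ * ((A : Matrix (Idx p q) (Idx p q) ℝ)ᵀ * eta p q * A) * B := by rw [hA]
      _ = (Bᵀ * (A : Matrix (Idx p q) (Idx p q) ℝ)ᵀ) * eta p q *
            ((A : Matrix (Idx p q) (Idx p q) ℝ) * B) := by simp only [Matrix.mul_assoc]
      _ = eta p q := by rw [h, h']; simp

/-- `SO(p,q) = {A ∈ O(p,q) | det A = 1}`. -/
def SO (p q : ℕ) : Subgroup (GL (Idx p q) ℝ) :=
  O p q ⊓ (Matrix.GeneralLinearGroup.det (n := Idx p q) (R := ℝ)).ker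

/-- The minor with rows and columns `1, …, p`. It is `1` if `p = 0`. -/
def upperMinor {p q : ℕ} (A : Matrix (Idx p q) (Idx p q) ℝ) : ℝ := A.toBlocks₁₁.det

/-- The minor with rows and columns `p + 1, …, n`. It is `1` if `q = 0`. -/
def lowerMinor {p q : ℕ} (A : Matrix (Idx p q) (Idx p q) ℝ) : ℝ := A.toBlocks₂₂.det

/-! Helper facts: matrices of `O(p,q)` with a minor at least `1` form a group. -/

section Minors

variable {m n : Type*} [Fintype m] [Fintype n] [DecidableEq m]

/-- `[a b; c d]` preserves the form `|x|² - |y|²`. -/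
def PresForm (a : Matrix m m ℝ) (b : Matrix m n ℝ) (c : Matrix n m ℝ) (d : Matrix n n ℝ) : Prop :=
  ∀ (x : m → ℝ) (y : n → ℝ),
    (a *ᵥ x + b *ᵥ y) ⬝ᵥ (a *ᵥ x + b *ᵥ y) - (c *ᵥ x + d *ᵥ y) ⬝ᵥ (c *ᵥ x + d *ᵥ y)
      = x ⬝ᵥ x - y ⬝ᵥ y

lemma dot_self_nonneg {k : Type*} [Fintype k] (x : k → ℝ) : 0 ≤ x ⬝ᵥ x :=
  Finset.sum_nonneg fun i _ => mul_self_nonneg (x i)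

lemma one_le_det_of_le {B : Matrix m m ℝ} (hB : B.IsHermitian)
    (h : ∀ x : m → ℝ, x ⬝ᵥ x ≤ x ⬝ᵥ (B *ᵥ x)) : 1 ≤ B.det := by
  rw [hB.det_eq_prod_eigenvalues]
  have key : ∀ i, 1 ≤ hB.eigenvalues i := by
    intro i
    have e := hB.eigenvalues_eq i
    have nrm := hB.eigenvectorBasis.orthonormal.1 i
    have h1 := h (hB.eigenvectorBasis i).ofLp
    have h2 : (hB.eigenvectorBasis i).ofLp ⬝ᵥ (hB.eigenvectorBasis i).ofLp = 1 := by
      have := EuclideanSpace.real_norm_sq_eq (hB.eigenvectorBasis i)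
      rw [nrm] at this
      simp only [dotProduct]
      rw [one_pow] at this
      rw [this]
      exact Finset.sum_congr rfl fun j _ => by ring
    rw [h2] at h1
    rw [e]
    simpa using h1
  have := Finset.prod_le_prod (s := Finset.univ) (f := fun _ : m => (1 : ℝ))
    (g := fun i => hB.eigenvalues i) (fun _ _ => zero_le_one) (fun i _ => key i)
  simpa using this

lemma PresForm.one_le_det_sq {a : Matrix m m ℝ} {b : Matrix m n ℝ} {c : Matrix n m ℝ}
    {d : Matrix n n ℝ} (h : PresForm a b c d) : 1 ≤ a.det * a.det := by
  have hH : (aᵀ * a).IsHermitian := by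
    rw [Matrix.IsHermitian, Matrix.conjTranspose_eq_transpose_of_trivial]
    simp
  have := one_le_det_of_le hH (fun x => by
    have h0 := h x 0
    have h1 := dot_self_nonneg (c *ᵥ x)
    have h2 : x ⬝ᵥ ((aᵀ * a) *ᵥ x) = (a *ᵥ x) ⬝ᵥ (a *ᵥ x) := by
      rw [← Matrix.mulVec_mulVec, Matrix.mulVec_transpose, dotProduct_comm,
        ← Matrix.dotProduct_mulVec]
    simp only [Matrix.mulVec_zero, add_zero, dotProduct_zero, sub_zero] at h0
    rw [h2]; linarith)
  simpa [Matrix.det_mul] using this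

lemma PresForm.det_pos_mul {a a' : Matrix m m ℝ} {b b' : Matrix m n ℝ} {c c' : Matrix n m ℝ}
    {d d' : Matrix n n ℝ} (h : PresForm a b c d) (h' : PresForm a' b' c' d')
    (ha : 0 < a.det) (ha' : 0 < a'.det) : 0 < (a * a' + b * c').det := by
  have hne : ∀ t ∈ Set.Icc (0 : ℝ) 1, (a * a' + t • (b * c')).det ≠ 0 := by
    intro t ht hdet
    obtain ⟨x, hx, hx0⟩ := Matrix.exists_mulVec_eq_zero_iff.mpr hdet
    have e1 := h (a' *ᵥ x) (t • (c' *ᵥ x))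
    have e2 := h' x 0
    have e3 : a *ᵥ (a' *ᵥ x) + b *ᵥ (t • (c' *ᵥ x)) = 0 := by
      rw [← hx0, Matrix.add_mulVec, Matrix.smul_mulVec, Matrix.mulVec_smul,
        Matrix.mulVec_mulVec, Matrix.mulVec_mulVec]
    rw [e3] at e1
    have n1 := dot_self_nonneg (c *ᵥ (a' *ᵥ x) + d *ᵥ (t • (c' *ᵥ x)))
    have n2 := dot_self_nonneg (c' *ᵥ x)
    have n3 : 0 < x ⬝ᵥ x :=
      lt_of_le_of_ne (dot_self_nonneg x) fun h0 => hx (dotProduct_self_eq_zero.mp h0.symm)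
    simp only [Matrix.mulVec_zero, add_zero, dotProduct_zero, sub_zero] at e2
    simp only [dotProduct_zero, dotProduct_smul, smul_dotProduct, smul_eq_mul] at e1
    have ht2 : t * (t * (c' *ᵥ x ⬝ᵥ c' *ᵥ x)) ≤ c' *ᵥ x ⬝ᵥ c' *ᵥ x := by
      have : t * t ≤ 1 := by nlinarith [ht.1, ht.2]
      nlinarith
    linarith
  have hcont : ContinuousOn (fun t : ℝ => (a * a' + t • (b * c')).det) (Set.Icc 0 1) := by
    apply Continuous.continuousOn
    apply Continuous.matrix_det
    fun_prop
  by_contra hneg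
  have h0 : (0 : ℝ) ∈ Set.Icc ((fun t : ℝ => (a * a' + t • (b * c')).det) 1)
      ((fun t : ℝ => (a * a' + t • (b * c')).det) 0) := by
    constructor
    · simpa using not_lt.mp hneg
    · simp only [zero_smul, add_zero, Matrix.det_mul]; positivity
  obtain ⟨t, ht, ht0⟩ := intermediate_value_Icc' zero_le_one hcont h0
  exact hne t ht ht0

lemma PresForm.one_le_det_mul {a a' : Matrix m m ℝ} {b b' : Matrix m n ℝ} {c c' : Matrix n m ℝ}
    {d d' : Matrix n n ℝ} (h : PresForm a b c d) (h' : PresForm a' b' c' d')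
    (hp : PresForm (a * a' + b * c') (a * b' + b * d') (c * a' + d * c') (c * b' + d * d'))
    (ha : 1 ≤ a.det) (ha' : 1 ≤ a'.det) : 1 ≤ (a * a' + b * c').det := by
  have h1 := h.det_pos_mul h' (by linarith) (by linarith)
  have h2 := hp.one_le_det_sq
  nlinarith

end Minors

lemma form_eq {p q : ℕ} (v : Idx p q → ℝ) :
    v ⬝ᵥ (eta p q *ᵥ v)
      = (v ∘ Sum.inl) ⬝ᵥ (v ∘ Sum.inl) - (v ∘ Sum.inr) ⬝ᵥ (v ∘ Sum.inr) := by
  simp [eta, sgn, dotProduct, Matrix.mulVec_diagonal, Fintype.sum_sum_type, sub_eq_add_neg]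

lemma presForm_of_mem {p q : ℕ} {A : GL (Idx p q) ℝ} (hA : A ∈ O p q) :
    PresForm A.val.toBlocks₁₁ A.val.toBlocks₁₂ A.val.toBlocks₂₁ A.val.toBlocks₂₂ := by
  intro x y
  have hA' : (A : Matrix (Idx p q) (Idx p q) ℝ)ᵀ * eta p q * A = eta p q := hA
  generalize A.val = M at *
  have h1 : (M *ᵥ Sum.elim x y) ⬝ᵥ (eta p q *ᵥ (M *ᵥ Sum.elim x y))
      = Sum.elim x y ⬝ᵥ (eta p q *ᵥ Sum.elim x y) := by
    have h0 : Sum.elim x y ⬝ᵥ ((Mᵀ * eta p q * M) *ᵥ Sum.elim x y)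
        = (M *ᵥ Sum.elim x y) ⬝ᵥ (eta p q *ᵥ (M *ᵥ Sum.elim x y)) := by
      rw [← Matrix.mulVec_mulVec, ← Matrix.mulVec_mulVec, Matrix.dotProduct_mulVec _ Mᵀ,
        Matrix.vecMul_transpose]
    rw [← h0, hA']
  rw [form_eq, form_eq] at h1
  have h2 : M *ᵥ Sum.elim x y = Sum.elim (M.toBlocks₁₁ *ᵥ x + M.toBlocks₁₂ *ᵥ y)
      (M.toBlocks₂₁ *ᵥ x + M.toBlocks₂₂ *ᵥ y) := by
    conv_lhs => rw [← Matrix.fromBlocks_toBlocks M]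
    rw [Matrix.fromBlocks_mulVec]
    simp
  rw [h2] at h1
  simpa using h1

lemma PresForm.swap {m n : Type*} [Fintype m] [Fintype n]
    {a : Matrix m m ℝ} {b : Matrix m n ℝ} {c : Matrix n m ℝ}
    {d : Matrix n n ℝ} (h : PresForm a b c d) : PresForm d c b a := by
  intro y x
  have := h x y
  rw [add_comm (a *ᵥ x), add_comm (c *ᵥ x)] at this
  linarith

lemma toBlocks_mul {p q : ℕ} (A B : Matrix (Idx p q) (Idx p q) ℝ) :
    A * B = Matrix.fromBlocks (A.toBlocks₁₁ * B.toBlocks₁₁ + A.toBlocks₁₂ * B.toBlocks₂₁)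
      (A.toBlocks₁₁ * B.toBlocks₁₂ + A.toBlocks₁₂ * B.toBlocks₂₂)
      (A.toBlocks₂₁ * B.toBlocks₁₁ + A.toBlocks₂₂ * B.toBlocks₂₁)
      (A.toBlocks₂₁ * B.toBlocks₁₂ + A.toBlocks₂₂ * B.toBlocks₂₂) := by
  conv_lhs => rw [← Matrix.fromBlocks_toBlocks A, ← Matrix.fromBlocks_toBlocks B]
  rw [Matrix.fromBlocks_multiply]

lemma inv_eq {p q : ℕ} {A : GL (Idx p q) ℝ} (hA : A ∈ O p q) :
    (A⁻¹).val = eta p q * A.valᵀ * eta p q := by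
  have hA' : A.valᵀ * eta p q * A = eta p q := hA
  apply Units.inv_eq_of_mul_eq_one_left
  rw [Matrix.mul_assoc, Matrix.mul_assoc, ← Matrix.mul_assoc A.valᵀ, hA', eta_mul_eta]

lemma inv_apply {p q : ℕ} {A : GL (Idx p q) ℝ} (hA : A ∈ O p q) (i j : Idx p q) :
    (A⁻¹).val i j = sgn p q i * A.val j i * sgn p q j := by
  rw [inv_eq hA, eta, Matrix.mul_diagonal, Matrix.diagonal_mul, Matrix.transpose_apply]

lemma upperMinor_inv {p q : ℕ} {A : GL (Idx p q) ℝ} (hA : A ∈ O p q) :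
    upperMinor (A⁻¹).val = upperMinor A.val := by
  rw [upperMinor, upperMinor, ← Matrix.det_transpose A.val.toBlocks₁₁]
  congr 1
  ext i j
  simp [Matrix.toBlocks₁₁, inv_apply hA, sgn, -Matrix.coe_units_inv]

lemma lowerMinor_inv {p q : ℕ} {A : GL (Idx p q) ℝ} (hA : A ∈ O p q) :
    lowerMinor (A⁻¹).val = lowerMinor A.val := by
  rw [lowerMinor, lowerMinor, ← Matrix.det_transpose A.val.toBlocks₂₂]
  congr 1
  ext i j
  simp [Matrix.toBlocks₂₂, inv_apply hA, sgn, -Matrix.coe_units_inv]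

lemma presForm_mul {p q : ℕ} {A B : GL (Idx p q) ℝ} (hA : A ∈ O p q) (hB : B ∈ O p q) :
    PresForm (A.val.toBlocks₁₁ * B.val.toBlocks₁₁ + A.val.toBlocks₁₂ * B.val.toBlocks₂₁)
      (A.val.toBlocks₁₁ * B.val.toBlocks₁₂ + A.val.toBlocks₁₂ * B.val.toBlocks₂₂)
      (A.val.toBlocks₂₁ * B.val.toBlocks₁₁ + A.val.toBlocks₂₂ * B.val.toBlocks₂₁)
      (A.val.toBlocks₂₁ * B.val.toBlocks₁₂ + A.val.toBlocks₂₂ * B.val.toBlocks₂₂) := by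
  have h := presForm_of_mem ((O p q).mul_mem hA hB)
  rw [Units.val_mul, toBlocks_mul] at h
  simpa only [Matrix.toBlocks_fromBlocks₁₁, Matrix.toBlocks_fromBlocks₁₂,
    Matrix.toBlocks_fromBlocks₂₁, Matrix.toBlocks_fromBlocks₂₂] using h

lemma one_le_upperMinor_mul {p q : ℕ} {A B : GL (Idx p q) ℝ} (hA : A ∈ O p q) (hB : B ∈ O p q)
    (ha : 1 ≤ upperMinor A.val) (hb : 1 ≤ upperMinor B.val) : 1 ≤ upperMinor (A * B).val := by
  rw [upperMinor, Units.val_mul, toBlocks_mul, Matrix.toBlocks_fromBlocks₁₁]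
  exact (presForm_of_mem hA).one_le_det_mul (presForm_of_mem hB) (presForm_mul hA hB) ha hb

lemma one_le_lowerMinor_mul {p q : ℕ} {A B : GL (Idx p q) ℝ} (hA : A ∈ O p q) (hB : B ∈ O p q)
    (ha : 1 ≤ lowerMinor A.val) (hb : 1 ≤ lowerMinor B.val) : 1 ≤ lowerMinor (A * B).val := by
  rw [lowerMinor, Units.val_mul, toBlocks_mul, Matrix.toBlocks_fromBlocks₂₂, add_comm]
  refine (presForm_of_mem hA).swap.one_le_det_mul (presForm_of_mem hB).swap ?_ ha hb
  have h := (presForm_mul hA hB).swap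
  rwa [add_comm (A.val.toBlocks₂₁ * B.val.toBlocks₁₂), add_comm (A.val.toBlocks₂₁ * _),
    add_comm (A.val.toBlocks₁₁ * B.val.toBlocks₁₂),
    add_comm (A.val.toBlocks₁₁ * B.val.toBlocks₁₁)] at h

/-- `O₊(p,q)`: the elements of `O(p,q)` whose minor with rows and columns `1, …, p` is `≥ 1`. -/
def OPlus (p q : ℕ) : Subgroup (GL (Idx p q) ℝ) where
  carrier := {A | A ∈ O p q ∧ 1 ≤ upperMinor A.val}
  one_mem' := ⟨(O p q).one_mem, by
    simp [upperMinor, ← Matrix.fromBlocks_one]⟩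
  mul_mem' := fun hA hB => ⟨(O p q).mul_mem hA.1 hB.1, one_le_upperMinor_mul hA.1 hB.1 hA.2 hB.2⟩
  inv_mem' := fun {A} hA => ⟨(O p q).inv_mem hA.1, (upperMinor_inv hA.1).symm ▸ hA.2⟩

/-- `O₋(p,q)`: the elements of `O(p,q)` whose minor with rows and columns `p + 1, …, n` is
`≥ 1`. -/
def OMinus (p q : ℕ) : Subgroup (GL (Idx p q) ℝ) where
  carrier := {A | A ∈ O p q ∧ 1 ≤ lowerMinor A.val}
  one_mem' := ⟨(O p q).one_mem, by
    simp [lowerMinor, ← Matrix.fromBlocks_one]⟩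
  mul_mem' := fun hA hB => ⟨(O p q).mul_mem hA.1 hB.1, one_le_lowerMinor_mul hA.1 hB.1 hA.2 hB.2⟩
  inv_mem' := fun {A} hA => ⟨(O p q).inv_mem hA.1, (lowerMinor_inv hA.1).symm ▸ hA.2⟩

/-- `SO₊(p,q)`: the elements of `SO(p,q)` whose minor with rows and columns `1, …, p` is `≥ 1`. -/
def SOPlus (p q : ℕ) : Subgroup (GL (Idx p q) ℝ) := SO p q ⊓ OPlus p q

/-! ### The Clifford algebra and its groups -/

open CliffordAlgebra

/-- The quadratic form `∑ a, η_aa x_a²` on `ℝⁿ`. -/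
def Q (p q : ℕ) : QuadraticForm ℝ (Idx p q → ℝ) := QuadraticMap.weightedSumSquares ℝ (sgn p q)

/-- The real Clifford algebra `Cl(p,q)`. -/
abbrev Cl (p q : ℕ) : Type := CliffordAlgebra (Q p q)

/-- The generators `e_a`. -/
def e (p q : ℕ) (a : Idx p q) : Cl p q := ι (Q p q) (Pi.single a 1)

/-- The subspace of grade `1` (the vectors). -/
def V (p q : ℕ) : Submodule ℝ (Cl p q) := LinearMap.range (ι (Q p q))

/-- The twisted adjoint representation `T ↦ (U ↦ T̂ U T⁻¹)`, `T̂` being the grade involution. -/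
def twistedAd (p q : ℕ) : (Cl p q)ˣ →* Module.End ℝ (Cl p q) where
  toFun T := LinearMap.mulLeft ℝ (involute (T : Cl p q)) ∘ₗ
    LinearMap.mulRight ℝ ((T⁻¹ : (Cl p q)ˣ) : Cl p q)
  map_one' := by ext x; simp
  map_mul' S T := by ext x; simp [mul_assoc]

@[simp]
lemma twistedAd_apply (p q : ℕ) (T : (Cl p q)ˣ) (U : Cl p q) :
    twistedAd p q T U = involute (T : Cl p q) * U * ((T⁻¹ : (Cl p q)ˣ) : Cl p q) := by
  simp [twistedAd, mul_assoc]

instance (p q : ℕ) : FiniteDimensional ℝ (V p q) :=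
  inferInstanceAs (FiniteDimensional ℝ (LinearMap.range (ι (Q p q))))

/-- If an invertible linear map sends the finite-dimensional space `V` into itself, so does its
inverse. -/
lemma inv_mem_V {p q : ℕ} (f g : Module.End ℝ (Cl p q)) (hgf : g * f = 1)
    (h : ∀ x ∈ V p q, f x ∈ V p q) : ∀ x ∈ V p q, g x ∈ V p q := by
  intro x hx
  have hg : ∀ y, g (f y) = y := fun y => by
    rw [← Module.End.mul_apply, hgf, Module.End.one_apply]
  have hinj : Function.Injective (f.restrict h) := by
    intro y z hyz
    have := congrArg (fun w : V p q => g w) hyz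
    simp only [LinearMap.restrict_apply, hg] at this
    exact Subtype.ext this
  obtain ⟨y, hy⟩ := LinearMap.injective_iff_surjective.mp hinj ⟨x, hx⟩
  have : f y = x := congrArg Subtype.val hy
  rw [← this, hg]
  exact y.2

/-- The Lipschitz group: the invertible `T` with `T̂ x T⁻¹ ∈ V` for all `x ∈ V`. -/
def Lipschitz (p q : ℕ) : Subgroup (Cl p q)ˣ where
  carrier := {T | ∀ x ∈ V p q, twistedAd p q T x ∈ V p q}
  one_mem' := by intro x hx; simpa using hx
  mul_mem' := by
    intro S T hS hT x hx
    rw [map_mul, Module.End.mul_apply]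
    exact hS _ (hT x hx)
  inv_mem' := by
    intro T hT
    exact inv_mem_V (twistedAd p q T) _ (by rw [← map_mul]; simp) hT

/-- The even elements are those fixed by the grade involution. -/
lemma mem_even_iff {p q : ℕ} (U : Cl p q) : U ∈ evenOdd (Q p q) 0 ↔ involute U = U := by
  refine ⟨involute_eq_of_mem_even, fun h => ?_⟩
  obtain ⟨a, ha, b, hb, rfl⟩ := Submodule.mem_sup.mp
    (((evenOdd_isCompl (Q := Q p q)).sup_eq_top).symm ▸ Submodule.mem_top (x := U))
  rw [map_add, involute_eq_of_mem_even ha, involute_eq_of_mem_odd hb] at h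
  have h2 : (2 : ℝ) • b = 0 := by
    rw [two_smul]
    have := add_left_cancel h
    nth_rewrite 1 [← this]
    simp
  have hb0 : b = 0 := (smul_eq_zero.mp h2).resolve_left two_ne_zero
  simpa [hb0] using ha

/-- The subgroup `Γ⁺` of the Clifford group: the invertible even `T` with `T x T⁻¹ ∈ V` for all
`x ∈ V`. -/
def GammaPlus (p q : ℕ) : Subgroup (Cl p q)ˣ where
  carrier := {T | (T : Cl p q) ∈ evenOdd (Q p q) 0 ∧
    ∀ x ∈ V p q, (T : Cl p q) * x * ((T⁻¹ : (Cl p q)ˣ) : Cl p q) ∈ V p q}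
  one_mem' := by
    refine ⟨by simp [mem_even_iff], fun x hx => by simpa using hx⟩
  mul_mem' := by
    intro S T hS hT
    refine ⟨?_, fun x hx => ?_⟩
    · have h1 := (mem_even_iff _).mp hS.1
      have h2 := (mem_even_iff _).mp hT.1
      simp [mem_even_iff, h1, h2]
    · have := hS.2 _ (hT.2 x hx)
      simpa [mul_assoc] using this
  inv_mem' := by
    intro T hT
    have h1 := (mem_even_iff _).mp hT.1
    have h2 : involute ((T⁻¹ : (Cl p q)ˣ) : Cl p q) = ((T⁻¹ : (Cl p q)ˣ) : Cl p q) := by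
      have : (T : Cl p q) * involute ((T⁻¹ : (Cl p q)ˣ) : Cl p q) = 1 := by
        conv_lhs => rw [← h1]
        rw [← map_mul]; simp
      exact (Units.inv_eq_of_mul_eq_one_right this).symm
    refine ⟨(mem_even_iff _).mpr h2, ?_⟩
    have hL : T ∈ Lipschitz p q := fun x hx => by
      rw [twistedAd_apply, h1]; exact hT.2 x hx
    intro x hx
    have := (Lipschitz p q).inv_mem hL x hx
    rwa [twistedAd_apply, h2] at this

lemma rev_mul_mul {p q : ℕ} (S T : Cl p q) :
    reverse (S * T) * (S * T) = reverse T * (reverse S * S) * T := by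
  simp [reverse.map_mul, mul_assoc]

/-- The invertible `T` with `T̃ T = e`, `T̃` being the reversion. -/
def revOne (p q : ℕ) : Subgroup (Cl p q)ˣ where
  carrier := {T | reverse (T : Cl p q) * (T : Cl p q) = 1}
  one_mem' := by simp
  mul_mem' := by
    intro S T hS hT
    simp only [Set.mem_ofPred_eq, Units.val_mul] at *
    rw [rev_mul_mul, hS, mul_one, hT]
  inv_mem' := by
    intro T hT
    simp only [Set.mem_ofPred_eq] at *
    have h1 : ((T⁻¹ : (Cl p q)ˣ) : Cl p q) = reverse (T : Cl p q) :=
      Units.inv_eq_of_mul_eq_one_left hT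
    rw [h1, reverse_reverse, ← h1]
    simp

/-- The invertible `T` with `T̃ T = ± e`. -/
def revPM (p q : ℕ) : Subgroup (Cl p q)ˣ where
  carrier := {T | reverse (T : Cl p q) * (T : Cl p q) = 1 ∨
    reverse (T : Cl p q) * (T : Cl p q) = -1}
  one_mem' := by simp
  mul_mem' := by
    intro S T hS hT
    simp only [Set.mem_ofPred_eq, Units.val_mul] at *
    rw [rev_mul_mul]
    rcases hS with hS | hS <;> rcases hT with hT | hT <;> simp [hS, hT]
  inv_mem' := by
    intro T hT
    simp only [Set.mem_ofPred_eq] at *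
    rcases hT with hT | hT
    · exact Or.inl ((revOne p q).inv_mem hT)
    · right
      have h1 : ((T⁻¹ : (Cl p q)ˣ) : Cl p q) = -reverse (T : Cl p q) :=
        Units.inv_eq_of_mul_eq_one_left (by rw [neg_mul, hT, neg_neg])
      have h2 : (T : Cl p q) * reverse (T : Cl p q) = -1 := by
        have : (T : Cl p q) * ((T⁻¹ : (Cl p q)ˣ) : Cl p q) = 1 := by simp
        rw [h1, mul_neg] at this
        rw [← this, neg_neg]
      rw [h1, map_neg, reverse_reverse, neg_mul_neg, h2]

/-- The invertible `T` with `T* T = e`, where the Clifford conjugate `T*` is the grade involution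
of the reversion of `T`. -/
def conjOne (p q : ℕ) : Subgroup (Cl p q)ˣ where
  carrier := {T | involute (reverse (T : Cl p q)) * (T : Cl p q) = 1}
  one_mem' := by simp
  mul_mem' := by
    intro S T hS hT
    simp only [Set.mem_ofPred_eq, Units.val_mul] at *
    calc _ = involute (reverse (T : Cl p q)) * (involute (reverse (S : Cl p q)) * S) * T := by
          simp [reverse.map_mul, mul_assoc]
      _ = 1 := by rw [hS, mul_one, hT]
  inv_mem' := by
    intro T hT
    simp only [Set.mem_ofPred_eq] at *
    have h1 : ((T⁻¹ : (Cl p q)ˣ) : Cl p q) = involute (reverse (T : Cl p q)) :=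
      Units.inv_eq_of_mul_eq_one_left hT
    have h2 : involute (reverse (involute (reverse (T : Cl p q)))) = (T : Cl p q) := by
      rw [reverse_involute, involute_involute, reverse_reverse]
    rw [h1, h2, ← h1]
    simp

/-- `Pin(p,q) = {T ∈ Γ± | T̃ T = ± e}`. -/
def Pin (p q : ℕ) : Subgroup (Cl p q)ˣ := Lipschitz p q ⊓ revPM p q

/-- `Pin₊(p,q) = {T ∈ Γ± | T* T = e}`, with `T*` the Clifford conjugate. -/
def PinPlus (p q : ℕ) : Subgroup (Cl p q)ˣ := Lipschitz p q ⊓ conjOne p q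

/-- `Pin₋(p,q) = {T ∈ Γ± | T̃ T = e}`, with the reversion. -/
def PinMinus (p q : ℕ) : Subgroup (Cl p q)ˣ := Lipschitz p q ⊓ revOne p q

/-- `Spin(p,q) = {T ∈ Γ⁺ | T̃ T = ± e}`. -/
def Spin (p q : ℕ) : Subgroup (Cl p q)ˣ := GammaPlus p q ⊓ revPM p q

/-- `Spin₊(p,q) = {T ∈ Γ⁺ | T̃ T = e}`. -/
def SpinPlus (p q : ℕ) : Subgroup (Cl p q)ˣ := GammaPlus p q ⊓ revOne p q

/-- The twisted adjoint representation induces a surjective homomorphism `G → H` with kernel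
`{e, -e}`: `T ∈ G` goes to the matrix `P ∈ H` of its action on `V` in the basis `e_1, …, e_n`,
that is `T̂ e_a T⁻¹ = ∑ b, P_ba e_b`. Since the `e_b` are linearly independent, the formula
determines the map. -/
def TwistedAdCovers {p q : ℕ} (G : Subgroup (Cl p q)ˣ) (H : Subgroup (GL (Idx p q) ℝ)) : Prop :=
  ∃ f : G →* H,
    (∀ (T : G) (a : Idx p q),
      twistedAd p q (T : (Cl p q)ˣ) (e p q a)
        = ∑ b, ((f T : GL (Idx p q) ℝ) : Matrix (Idx p q) (Idx p q) ℝ) b a • e p q b) ∧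
    Function.Surjective f ∧
    ((↑) '' (f.ker : Set G) : Set (Cl p q)ˣ) = {1, -1}

end SpinCover

end

noncomputable section

namespace SpinCover

open CliffordAlgebra

/-! ### Elements of the Clifford algebra that supercommute with all vectors -/

/-! The matrix of $x\mapsto\widehat T x T^{-1}$ preserves η, and it is the identity only if $T$
supercommutes with every vector, which forces $T$ to be a scalar (`exists_eq_algebraMap`). An
anisotropic vector $v$ acts as the reflection along $v$, and reflections generate $\mathrm O(p,q)$
(Cartan–Dieudonné, `exists_hasSigns_adMatrix_eq`). Hence every element of $\Gamma^\pm$ is a real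
multiple of a product of anisotropic vectors.

What remains is to translate conditions on $T$ into conditions on its matrix. For a vector,
$\widehat v=-v$ and the reflection has determinant $-1$; the norm $\widetilde v v=Q(v)$ has the sign
of the lower minor, and $\widehat{\widetilde v}v=-Q(v)$ that of the upper minor. These rules survive
products because the sign of each minor is a homomorphism on $\mathrm O(p,q)$
(`PresForm.det_mul_pos`), and survive real scaling because norms scale by squares; so they hold on
all of $\Gamma^\pm$ (`hasSigns`). Since the minors have absolute value at least $1$, a norm known to
be $\pm1$ equals $1$ exactly when the matching minor is $\ge1$.

So each of the five groups is the full preimage of its target in $\mathrm{Pin}(p,q)$, and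
`twistedAdCovers_of_le_pin` treats them all: scaling to norm $\pm1$ gives surjectivity, and a scalar
$c$ with $c^2=\pm1$ is $\pm1$. -/

lemma ι_injective (p q : ℕ) : Function.Injective (ι (Q p q)) := by
  intro x y h
  let _ : Invertible (2 : ℝ) := invertibleOfNonzero two_ne_zero
  -- Since 2 is invertible, the Clifford algebra is linearly the exterior algebra, and this
  -- identification fixes vectors.
  have h' := congrArg (equivExterior (Q p q)) h
  simp only [equivExterior, changeFormEquiv_apply, changeForm_ι] at h'
  exact (ExteriorAlgebra.ι_inj ℝ x y).mp h'

/-! ### The quadratic form and the generators in coordinates. -/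

lemma Q_eq_dotProduct {p q : ℕ} (x : Idx p q → ℝ) : Q p q x = x ⬝ᵥ (eta p q *ᵥ x) := by
  simp [Q, eta, dotProduct, Matrix.mulVec_diagonal, QuadraticMap.weightedSumSquares_apply,
    mul_left_comm]

lemma polar_eq_dotProduct {p q : ℕ} (x y : Idx p q → ℝ) :
    QuadraticMap.polar (Q p q) x y = 2 * (x ⬝ᵥ (eta p q *ᵥ y)) := by
  simp only [QuadraticMap.polar, Q, eta, dotProduct, Matrix.mulVec_diagonal,
    QuadraticMap.weightedSumSquares_apply, Pi.add_apply, smul_eq_mul, ← Finset.sum_sub_distrib,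
    Finset.mul_sum]
  exact Finset.sum_congr rfl fun i _ => by ring

lemma sgn_mul_self {p q : ℕ} (a : Idx p q) : sgn p q a * sgn p q a = 1 := by
  rcases a with a | a <;> simp [sgn]

lemma sgn_ne_zero {p q : ℕ} (a : Idx p q) : sgn p q a ≠ 0 := fun h => by
  simpa [h] using sgn_mul_self a

lemma Q_single {p q : ℕ} (a : Idx p q) : Q p q (Pi.single a 1) = sgn p q a := by
  simp [Q_eq_dotProduct, eta]

lemma e_mul_self {p q : ℕ} (a : Idx p q) : e p q a * e p q a = algebraMap ℝ _ (sgn p q a) := by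
  rw [e, ι_sq_scalar, Q_single]

lemma e_mul_e {p q : ℕ} {a b : Idx p q} (h : a ≠ b) :
    e p q a * e p q b = -(e p q b * e p q a) := by
  rw [eq_neg_iff_add_eq_zero, e, e, ι_mul_ι_add_swap, polar_eq_dotProduct]
  simp [eta, h]

lemma ι_eq_sum {p q : ℕ} (x : Idx p q → ℝ) : ι (Q p q) x = ∑ a, x a • e p q a := by
  conv_lhs => rw [pi_eq_sum_univ' x]
  simp only [map_sum, map_smul, e]

/-- The subalgebra generated by the `e_b` with `b ∈ S`. -/
def coordSubalgebra (p q : ℕ) (S : Set (Idx p q)) : Subalgebra ℝ (Cl p q) :=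
  Algebra.adjoin ℝ (e p q '' S)

lemma e_mem_coordSubalgebra {p q : ℕ} {S : Set (Idx p q)} {a : Idx p q} (h : a ∈ S) :
    e p q a ∈ coordSubalgebra p q S :=
  Algebra.subset_adjoin ⟨a, h, rfl⟩

/-- The subalgebra is spanned by words in the generators, so closure under prefixing one generator
replaces closure under all products. -/
lemma coordSubalgebra_induction {p q : ℕ} {S : Set (Idx p q)} {P : Cl p q → Prop}
    (one : P 1) (add : ∀ x y, P x → P y → P (x + y)) (smul : ∀ (r : ℝ) x, P x → P (r • x))
    (mul : ∀ b ∈ S, ∀ x, P x → P (e p q b * x)) {x : Cl p q}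
    (hx : x ∈ coordSubalgebra p q S) : P x := by
  rw [coordSubalgebra, ← Subalgebra.mem_toSubmodule, Algebra.adjoin_eq_span] at hx
  induction hx using Submodule.span_induction with
  | zero => simpa using smul 0 1 one
  | add x y _ _ hx hy => exact add x y hx hy
  | smul r x _ hx => exact smul r x hx
  | mem x hx =>
    induction hx using Submonoid.closure_induction_left with
    | one => exact one
    | mul_left x hx y _ hy =>
      obtain ⟨b, hb, rfl⟩ := hx
      exact mul b hb y hy

lemma involute_e {p q : ℕ} (a : Idx p q) : involute (e p q a) = -e p q a := involute_ι _

/-- Each letter of a word anticommutes with $e_a$, and the grade involution contributes the same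
sign. -/
lemma involute_mul_e {p q : ℕ} {S : Set (Idx p q)} {a : Idx p q} (ha : a ∉ S) {x : Cl p q}
    (hx : x ∈ coordSubalgebra p q S) : involute x * e p q a = e p q a * x := by
  refine coordSubalgebra_induction (P := fun x => involute x * e p q a = e p q a * x)
    (by simp) (fun x y hx hy => ?_) (fun r x hx => ?_) (fun b hb x hx => ?_) hx
  · rw [map_add, add_mul, hx, hy, mul_add]
  · rw [map_smul, smul_mul_assoc, hx, mul_smul_comm]
  · have hab : b ≠ a := fun h => ha (h ▸ hb)
    rw [map_mul, mul_assoc, hx, involute_e, ← mul_assoc, neg_mul, e_mul_e hab, neg_neg, mul_assoc]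

/-- Anticommutation moves every $e_a$ to the front of a word, where $e_a^2=\pm1$ leaves at most one.
-/
lemma exists_add_e_mul {p q : ℕ} {S : Set (Idx p q)} (a : Idx p q) {x : Cl p q}
    (hx : x ∈ coordSubalgebra p q S) :
    ∃ u ∈ coordSubalgebra p q (S \ {a}), ∃ w ∈ coordSubalgebra p q (S \ {a}),
      x = u + e p q a * w := by
  refine coordSubalgebra_induction (P := fun x => ∃ u ∈ coordSubalgebra p q (S \ {a}),
    ∃ w ∈ coordSubalgebra p q (S \ {a}), x = u + e p q a * w)
    ⟨1, one_mem _, 0, zero_mem _, by simp⟩ ?_ ?_ ?_ hx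
  · intro x y hx hy
    obtain ⟨u, hu, w, hw, rfl⟩ := hx
    obtain ⟨u', hu', w', hw', rfl⟩ := hy
    exact ⟨u + u', add_mem hu hu', w + w', add_mem hw hw', by rw [mul_add]; abel⟩
  · intro r x hx
    obtain ⟨u, hu, w, hw, rfl⟩ := hx
    exact ⟨r • u, Subalgebra.smul_mem _ hu r, r • w, Subalgebra.smul_mem _ hw r, by
      rw [smul_add, mul_smul_comm]⟩
  · intro b hb x hx
    obtain ⟨u, hu, w, hw, rfl⟩ := hx
    by_cases hba : b = a
    · subst hba
      refine ⟨sgn p q b • w, Subalgebra.smul_mem _ hw _, u, hu, ?_⟩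
      rw [mul_add, ← mul_assoc, e_mul_self, Algebra.smul_def, add_comm]
    · have hm := e_mem_coordSubalgebra (p := p) (q := q) (S := S \ {a}) ⟨hb, hba⟩
      refine ⟨_, mul_mem hm hu, -(e p q b * w), neg_mem (mul_mem hm hw), ?_⟩
      rw [mul_add, ← mul_assoc, e_mul_e hba]
      simp [mul_assoc]

/-- Write $x=u+e_aw$ with $u,w$ free of $e_a$. The part $u$ satisfies the relation automatically,
while $e_aw$ gives $-\eta_{aa}w$ on one side and $\eta_{aa}w$ on the other, so $w=0$. -/
lemma mem_coordSubalgebra_diff {p q : ℕ} {S : Set (Idx p q)} {a : Idx p q} {x : Cl p q}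
    (hx : x ∈ coordSubalgebra p q S) (h : involute x * e p q a = e p q a * x) :
    x ∈ coordSubalgebra p q (S \ {a}) := by
  obtain ⟨u, hu, w, hw, rfl⟩ := exists_add_e_mul a hx
  have ha : a ∉ S \ {a} := by simp
  rw [map_add, add_mul, mul_add, involute_mul_e ha hu, map_mul, mul_assoc, involute_mul_e ha hw,
    involute_e, neg_mul, add_right_inj, ← mul_assoc, e_mul_self, ← Algebra.smul_def,
    neg_eq_iff_add_eq_zero, ← two_smul ℝ] at h
  have hw0 : w = 0 := by simpa [sgn_ne_zero] using h
  simpa [hw0] using hu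

lemma coordSubalgebra_univ (p q : ℕ) : coordSubalgebra p q Set.univ = ⊤ := by
  rw [eq_top_iff, ← adjoin_range_ι, Algebra.adjoin_le_iff]
  rintro _ ⟨x, rfl⟩
  rw [ι_eq_sum]
  exact sum_mem fun a _ => Subalgebra.smul_mem _ (e_mem_coordSubalgebra (Set.mem_univ a)) _

/-- An element that supercommutes with all vectors is a scalar. -/
lemma exists_eq_algebraMap {p q : ℕ} {x : Cl p q}
    (h : ∀ a, involute x * e p q a = e p q a * x) : ∃ c : ℝ, x = algebraMap ℝ _ c := by
  -- The generators are eliminated one at a time; with none left only scalars remain.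
  have key : ∀ S : Finset (Idx p q), x ∈ coordSubalgebra p q (Set.univ \ S) := by
    intro S
    induction S using Finset.induction_on with
    | empty => simp [coordSubalgebra_univ]
    | insert a S _ ih =>
      have := mem_coordSubalgebra_diff ih (h a)
      rwa [Set.sdiff_sdiff, Set.union_singleton, ← Finset.coe_insert] at this
  have := key Finset.univ
  rw [Finset.coe_univ, Set.sdiff_self, coordSubalgebra, Set.image_empty, Algebra.adjoin_empty,
    Algebra.mem_bot] at this
  exact this.imp fun c hc => hc.symm

/-! ### The homomorphism from the Lipschitz group to `GL(n)` -/

/-- The vectors of the Clifford algebra, in coordinates. -/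
def vecEquiv (p q : ℕ) : (Idx p q → ℝ) ≃ₗ[ℝ] V p q :=
  LinearEquiv.ofInjective (ι (Q p q)) (ι_injective p q)

lemma coe_vecEquiv {p q : ℕ} (x : Idx p q → ℝ) : (vecEquiv p q x : Cl p q) = ι (Q p q) x := rfl

lemma ι_vecEquiv_symm {p q : ℕ} (x : V p q) : ι (Q p q) ((vecEquiv p q).symm x) = x := by
  rw [← coe_vecEquiv, LinearEquiv.apply_symm_apply]

/-- The twisted adjoint action of the Lipschitz group on `ℝⁿ`. -/
def vecAct (p q : ℕ) : Lipschitz p q →* Module.End ℝ (Idx p q → ℝ) where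
  toFun T := (vecEquiv p q).symm.toLinearMap ∘ₗ (twistedAd p q T).restrict T.2 ∘ₗ
    (vecEquiv p q).toLinearMap
  map_one' := by
    ext1; ext1; apply ι_injective p q
    simp [ι_vecEquiv_symm, coe_vecEquiv]
  map_mul' S T := by
    apply LinearMap.ext; intro x; apply ι_injective p q
    simp only [LinearMap.comp_apply, Module.End.mul_apply, LinearEquiv.coe_coe,
      LinearEquiv.apply_symm_apply, ι_vecEquiv_symm]
    change twistedAd p q (S * T : Lipschitz p q) (ι (Q p q) x) =
      twistedAd p q S (twistedAd p q T (ι (Q p q) x))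
    rw [Subgroup.coe_mul, map_mul, Module.End.mul_apply]

lemma ι_vecAct {p q : ℕ} (T : Lipschitz p q) (x : Idx p q → ℝ) :
    ι (Q p q) (vecAct p q T x) = twistedAd p q T (ι (Q p q) x) :=
  ι_vecEquiv_symm _

/-- The matrix of the twisted adjoint action. -/
def adMatrix (p q : ℕ) : Lipschitz p q →* GL (Idx p q) ℝ :=
  ((LinearMap.toMatrixAlgEquiv' (R := ℝ) (n := Idx p q)).toMulEquiv.toMonoidHom.comp
    (vecAct p q)).toHomUnits

lemma adMatrix_mulVec {p q : ℕ} (T : Lipschitz p q) (x : Idx p q → ℝ) :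
    (adMatrix p q T).val *ᵥ x = vecAct p q T x := by
  change LinearMap.toMatrixAlgEquiv' (vecAct p q T) *ᵥ x = _
  rw [← Matrix.toLinAlgEquiv'_apply]
  simp

lemma ι_adMatrix_mulVec {p q : ℕ} (T : Lipschitz p q) (x : Idx p q → ℝ) :
    ι (Q p q) ((adMatrix p q T).val *ᵥ x) = twistedAd p q T (ι (Q p q) x) := by
  rw [adMatrix_mulVec, ι_vecAct]

lemma twistedAd_e {p q : ℕ} (T : Lipschitz p q) (a : Idx p q) :
    twistedAd p q T (e p q a) = ∑ b, (adMatrix p q T).val b a • e p q b := by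
  rw [e, ← ι_adMatrix_mulVec, ι_eq_sum]
  simp

lemma adMatrix_eq_of_mulVec {p q : ℕ} {T : Lipschitz p q} {A : GL (Idx p q) ℝ}
    (h : ∀ x, ι (Q p q) (A.val *ᵥ x) = twistedAd p q T (ι (Q p q) x)) : adMatrix p q T = A := by
  refine Units.ext (Matrix.mulVec_injective (funext fun x => ι_injective p q ?_))
  rw [ι_adMatrix_mulVec, h]

lemma mem_O_iff {p q : ℕ} {A : GL (Idx p q) ℝ} :
    A ∈ O p q ↔ ∀ x, Q p q (A.val *ᵥ x) = Q p q x := by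
  have hO : A ∈ O p q ↔ A.valᵀ * eta p q * A.val = eta p q := Iff.rfl
  have hd : ∀ x y, (A.val *ᵥ x) ⬝ᵥ (eta p q *ᵥ (A.val *ᵥ y))
      = x ⬝ᵥ ((A.valᵀ * eta p q * A.val) *ᵥ y) := fun x y => by
    rw [← Matrix.mulVec_mulVec, ← Matrix.mulVec_mulVec, Matrix.dotProduct_mulVec _ A.valᵀ,
      Matrix.vecMul_transpose]
  refine ⟨fun h x => ?_, fun h => ?_⟩
  · rw [Q_eq_dotProduct, Q_eq_dotProduct, hd, hO.mp h]
  · rw [hO]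
    ext i j
    have h1 : QuadraticMap.polar (Q p q) (A.val *ᵥ Pi.single i 1) (A.val *ᵥ Pi.single j 1)
        = QuadraticMap.polar (Q p q) (Pi.single i 1) (Pi.single j 1) := by
      simp only [QuadraticMap.polar, ← Matrix.mulVec_add, h]
    rw [polar_eq_dotProduct, polar_eq_dotProduct, hd] at h1
    simpa using h1

/-- For $y=\widehat T x T^{-1}\in V$, applying the involution gives also $y=T x\,\widehat{T^{-1}}$.
Multiplying the two expressions, $y^2=\widehat T x^2\,\widehat{T^{-1}}=Q(x)$. -/
lemma adMatrix_mem_O {p q : ℕ} (T : Lipschitz p q) : adMatrix p q T ∈ O p q := by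
  rw [mem_O_iff]
  intro x
  apply (algebraMap ℝ (Cl p q)).injective
  have h1 := ι_adMatrix_mulVec T x
  have h2 := congrArg involute h1
  rw [← ι_sq_scalar, ← ι_sq_scalar]
  have h3 : involute (T : (Cl p q)ˣ).val * involute ((T : (Cl p q)ˣ)⁻¹).val = 1 := by
    rw [← map_mul]; simp
  simp only [twistedAd_apply, map_mul, involute_ι, involute_involute, mul_neg, neg_mul,
    neg_inj] at h1 h2
  conv_lhs => enter [1]; rw [h1]
  rw [h2]
  simp only [mul_assoc, Units.inv_mul_cancel_left]
  rw [← mul_assoc (ι _ x), ι_sq_scalar, Algebra.left_comm, h3, mul_one]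

/-- The elements of the Lipschitz group that act trivially are scalars. -/
lemma exists_eq_algebraMap_of_adMatrix_eq_one {p q : ℕ} {T : Lipschitz p q}
    (h : adMatrix p q T = 1) : ∃ c : ℝ, (T : (Cl p q)ˣ).val = algebraMap ℝ _ c := by
  refine exists_eq_algebraMap fun a => ?_
  have h1 := ι_adMatrix_mulVec T (Pi.single a 1)
  rw [h, Units.val_one, Matrix.one_mulVec, twistedAd_apply] at h1
  rwa [Units.eq_mul_inv_iff_mul_eq, eq_comm] at h1

/-! ### Signs of the minors -/

section Minors

variable {m n : Type*} [Fintype m] [Fintype n] [DecidableEq m]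

lemma PresForm.det_ne_zero {a : Matrix m m ℝ} {b : Matrix m n ℝ} {c : Matrix n m ℝ}
    {d : Matrix n n ℝ} (h : PresForm a b c d) : a.det ≠ 0 := fun h0 => by
  simpa [h0] using (h.one_le_det_sq).trans_lt' one_pos

/-- Along $aa'+t\,bc'$, $0\le t\le1$, the determinant never vanishes: for $x\neq0$ in the kernel,
the form at $(a'x,\,t\,c'x)$ would be at least $|a'x|^2-|c'x|^2=|x|^2>0$, yet its image has first
component zero. So the sign is that at $t=0$; the factor `a.det * a'.det` covers all sign
combinations at once. -/
lemma PresForm.det_mul_pos {a a' : Matrix m m ℝ} {b b' : Matrix m n ℝ} {c c' : Matrix n m ℝ}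
    {d d' : Matrix n n ℝ} (h : PresForm a b c d) (h' : PresForm a' b' c' d') :
    0 < a.det * a'.det * (a * a' + b * c').det := by
  have hne : ∀ t ∈ Set.Icc (0 : ℝ) 1, a.det * a'.det * (a * a' + t • (b * c')).det ≠ 0 := by
    intro t ht
    refine mul_ne_zero (mul_ne_zero h.det_ne_zero h'.det_ne_zero) fun hdet => ?_
    obtain ⟨x, hx, hx0⟩ := Matrix.exists_mulVec_eq_zero_iff.mpr hdet
    have e1 := h (a' *ᵥ x) (t • (c' *ᵥ x))
    have e2 := h' x 0
    have e3 : a *ᵥ (a' *ᵥ x) + b *ᵥ (t • (c' *ᵥ x)) = 0 := by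
      rw [← hx0, Matrix.add_mulVec, Matrix.smul_mulVec, Matrix.mulVec_smul,
        Matrix.mulVec_mulVec, Matrix.mulVec_mulVec]
    rw [e3] at e1
    have n1 := dot_self_nonneg (c *ᵥ (a' *ᵥ x) + d *ᵥ (t • (c' *ᵥ x)))
    have n2 := dot_self_nonneg (c' *ᵥ x)
    have n3 : 0 < x ⬝ᵥ x :=
      lt_of_le_of_ne (dot_self_nonneg x) fun h0 => hx (dotProduct_self_eq_zero.mp h0.symm)
    simp only [Matrix.mulVec_zero, add_zero, dotProduct_zero, sub_zero] at e2
    simp only [dotProduct_zero, dotProduct_smul, smul_dotProduct, smul_eq_mul] at e1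
    have ht2 : t * (t * (c' *ᵥ x ⬝ᵥ c' *ᵥ x)) ≤ c' *ᵥ x ⬝ᵥ c' *ᵥ x := by
      have : t * t ≤ 1 := by nlinarith [ht.1, ht.2]
      nlinarith
    linarith
  have hcont : ContinuousOn (fun t : ℝ => a.det * a'.det * (a * a' + t • (b * c')).det)
      (Set.Icc 0 1) := by
    apply Continuous.continuousOn
    apply Continuous.mul continuous_const
    apply Continuous.matrix_det
    fun_prop
  by_contra hneg
  have h0 : (0 : ℝ) ∈ Set.Icc
      ((fun t : ℝ => a.det * a'.det * (a * a' + t • (b * c')).det) 1)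
      ((fun t : ℝ => a.det * a'.det * (a * a' + t • (b * c')).det) 0) := by
    constructor
    · simpa using not_lt.mp hneg
    · simp only [zero_smul, add_zero, Matrix.det_mul]
      exact mul_self_nonneg _
  obtain ⟨t, ht, ht0⟩ := intermediate_value_Icc' zero_le_one hcont h0
  exact hne t ht ht0

/-- The matrix determinant lemma. A reflection and both its diagonal blocks are rank-one
perturbations of the identity, so it yields the determinant and both minors. -/
lemma det_one_sub_smul_vecMulVec (c : ℝ) (u w : m → ℝ) :
    (1 - c • Matrix.vecMulVec u w).det = 1 - c * (w ⬝ᵥ u) := by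
  have h := Matrix.det_one_add_replicateCol_mul_replicateRow (ι := Unit) (-c • u) w
  rw [← Matrix.vecMulVec_eq, Matrix.smul_vecMulVec, neg_smul, ← sub_eq_add_neg] at h
  rw [h, dotProduct_smul, smul_eq_mul, neg_mul, ← sub_eq_add_neg]

end Minors

section

variable {p q : ℕ} {A B : GL (Idx p q) ℝ}

lemma upperMinor_mul_pos (hA : A ∈ O p q) (hB : B ∈ O p q) :
    0 < upperMinor A.val * upperMinor B.val * upperMinor (A * B).val := by
  have := (presForm_of_mem hA).det_mul_pos (presForm_of_mem hB)
  rwa [upperMinor, upperMinor, upperMinor, Units.val_mul, toBlocks_mul,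
    Matrix.toBlocks_fromBlocks₁₁]

lemma lowerMinor_mul_pos (hA : A ∈ O p q) (hB : B ∈ O p q) :
    0 < lowerMinor A.val * lowerMinor B.val * lowerMinor (A * B).val := by
  have := (presForm_of_mem hA).swap.det_mul_pos (presForm_of_mem hB).swap
  rwa [lowerMinor, lowerMinor, lowerMinor, Units.val_mul, toBlocks_mul,
    Matrix.toBlocks_fromBlocks₂₂, add_comm]

lemma one_le_upperMinor_sq (hA : A ∈ O p q) : 1 ≤ upperMinor A.val * upperMinor A.val :=
  (presForm_of_mem hA).one_le_det_sq

lemma one_le_lowerMinor_sq (hA : A ∈ O p q) : 1 ≤ lowerMinor A.val * lowerMinor A.val :=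
  (presForm_of_mem hA).swap.one_le_det_sq

/-! ### Reflections -/

/-- The matrix of the reflection along `v`. -/
def reflMatrix (v : Idx p q → ℝ) : Matrix (Idx p q) (Idx p q) ℝ :=
  1 - (2 / Q p q v) • Matrix.vecMulVec v (eta p q *ᵥ v)

lemma Q_eq_sub (v : Idx p q → ℝ) : Q p q v =
    (v ∘ Sum.inl) ⬝ᵥ (v ∘ Sum.inl) - (v ∘ Sum.inr) ⬝ᵥ (v ∘ Sum.inr) := by
  rw [Q_eq_dotProduct, form_eq]

lemma reflMatrix_mulVec (v x : Idx p q → ℝ) :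
    reflMatrix v *ᵥ x = x - (QuadraticMap.polar (Q p q) x v / Q p q v) • v := by
  rw [reflMatrix, Matrix.sub_mulVec, Matrix.one_mulVec, Matrix.smul_mulVec,
    Matrix.vecMulVec_mulVec, polar_eq_dotProduct, dotProduct_comm]
  congr 1
  ext i
  simp
  ring

lemma det_reflMatrix {v : Idx p q → ℝ} (hv : Q p q v ≠ 0) : (reflMatrix v).det = -1 := by
  rw [reflMatrix, det_one_sub_smul_vecMulVec, dotProduct_comm, ← Q_eq_dotProduct]
  field_simp
  norm_num

lemma upperMinor_reflMatrix (v : Idx p q → ℝ) :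
    upperMinor (reflMatrix v) = 1 - 2 / Q p q v * ((v ∘ Sum.inl) ⬝ᵥ (v ∘ Sum.inl)) := by
  rw [← det_one_sub_smul_vecMulVec, upperMinor]
  congr 1
  ext i j
  simp [reflMatrix, Matrix.toBlocks₁₁, Matrix.vecMulVec_apply, eta, sgn, Matrix.mulVec_diagonal,
    Matrix.one_apply]

lemma lowerMinor_reflMatrix (v : Idx p q → ℝ) :
    lowerMinor (reflMatrix v) = 1 + 2 / Q p q v * ((v ∘ Sum.inr) ⬝ᵥ (v ∘ Sum.inr)) := by
  rw [← sub_neg_eq_add, ← neg_mul, ← det_one_sub_smul_vecMulVec, lowerMinor]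
  congr 1
  ext i j
  simp [reflMatrix, Matrix.toBlocks₂₂, Matrix.vecMulVec_apply, eta, sgn, Matrix.mulVec_diagonal,
    Matrix.one_apply]

/-- The product is the Euclidean square $|v|^2$, which is positive for an anisotropic $v$. -/
lemma upperMinor_reflMatrix_neg {v : Idx p q → ℝ} (hv : Q p q v ≠ 0) :
    0 < -Q p q v * upperMinor (reflMatrix v) := by
  have h1 := dot_self_nonneg (v ∘ Sum.inl)
  have h2 := dot_self_nonneg (v ∘ Sum.inr)
  have h3 := Q_eq_sub v
  have h4 : -Q p q v * upperMinor (reflMatrix v) =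
      (v ∘ Sum.inl) ⬝ᵥ (v ∘ Sum.inl) + (v ∘ Sum.inr) ⬝ᵥ (v ∘ Sum.inr) := by
    rw [upperMinor_reflMatrix]
    field_simp
    rw [h3]; ring
  rw [h4]
  refine lt_of_le_of_ne (by positivity) fun h => hv ?_
  rw [h3]; linarith

lemma lowerMinor_reflMatrix_pos {v : Idx p q → ℝ} (hv : Q p q v ≠ 0) :
    0 < Q p q v * lowerMinor (reflMatrix v) := by
  have h1 := dot_self_nonneg (v ∘ Sum.inl)
  have h2 := dot_self_nonneg (v ∘ Sum.inr)
  have h3 := Q_eq_sub v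
  have h4 : Q p q v * lowerMinor (reflMatrix v) =
      (v ∘ Sum.inl) ⬝ᵥ (v ∘ Sum.inl) + (v ∘ Sum.inr) ⬝ᵥ (v ∘ Sum.inr) := by
    rw [lowerMinor_reflMatrix]
    field_simp
    rw [h3]; ring
  rw [h4]
  refine lt_of_le_of_ne (by positivity) fun h => hv ?_
  rw [h3]; linarith

/-- An anisotropic vector as a unit of the Clifford algebra. -/
def vecUnit (v : Idx p q → ℝ) (hv : Q p q v ≠ 0) : (Cl p q)ˣ where
  val := ι (Q p q) v
  inv := (Q p q v)⁻¹ • ι (Q p q) v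
  val_inv := by
    rw [mul_smul_comm, ι_sq_scalar, Algebra.algebraMap_eq_smul_one, smul_smul, inv_mul_cancel₀ hv,
      one_smul]
  inv_val := by
    rw [smul_mul_assoc, ι_sq_scalar, Algebra.algebraMap_eq_smul_one, smul_smul, inv_mul_cancel₀ hv,
      one_smul]

/-- The identity $vxv=2\langle v,x\rangle v-Q(v)x$ makes $vxv^{-1}$ the negative of the reflection;
the sign of $\widehat v=-v$ corrects this. -/
lemma twistedAd_vecUnit {v : Idx p q → ℝ} (hv : Q p q v ≠ 0) (x : Idx p q → ℝ) :
    twistedAd p q (vecUnit v hv) (ι (Q p q) x) = ι (Q p q) (reflMatrix v *ᵥ x) := by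
  have h1 : (vecUnit v hv).val = ι (Q p q) v := rfl
  have h2 : ((vecUnit v hv)⁻¹).val = (Q p q v)⁻¹ • ι (Q p q) v := rfl
  rw [twistedAd_apply, h1, h2, involute_ι, mul_smul_comm, neg_mul, neg_mul, ι_mul_ι_mul_ι,
    ← map_neg, ← map_smul, reflMatrix_mulVec, QuadraticMap.polar_comm]
  congr 1
  rw [neg_sub, smul_sub, smul_smul, smul_smul, inv_mul_cancel₀ hv, one_smul, div_eq_inv_mul]

/-- An anisotropic vector as an element of the Lipschitz group. -/
def lipVec (v : Idx p q → ℝ) (hv : Q p q v ≠ 0) : Lipschitz p q :=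
  ⟨vecUnit v hv, by
    rintro _ ⟨x, rfl⟩
    rw [twistedAd_vecUnit]
    exact ⟨_, rfl⟩⟩

lemma adMatrix_lipVec {v : Idx p q → ℝ} (hv : Q p q v ≠ 0) :
    (adMatrix p q (lipVec v hv)).val = reflMatrix v := by
  refine Matrix.mulVec_injective (funext fun x => ι_injective p q ?_)
  rw [ι_adMatrix_mulVec]
  exact twistedAd_vecUnit hv x

/-! ### Parity and norms in the Lipschitz group -/

/-- `T` is homogeneous with parity given by the determinant of its action, and its two norms are
scalars with the signs of the two minors of its action. -/
structure HasSigns (T : Lipschitz p q) : Prop where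
  involute_eq : involute (T : (Cl p q)ˣ).val = (adMatrix p q T).val.det • (T : (Cl p q)ˣ).val
  reverse_mul : ∃ r : ℝ, reverse (T : (Cl p q)ˣ).val * (T : (Cl p q)ˣ).val = algebraMap ℝ _ r ∧
    0 < r * lowerMinor (adMatrix p q T).val
  conj_mul : ∃ r : ℝ,
    involute (reverse (T : (Cl p q)ˣ).val) * (T : (Cl p q)ˣ).val = algebraMap ℝ _ r ∧
      0 < r * upperMinor (adMatrix p q T).val

lemma HasSigns.one : HasSigns (1 : Lipschitz p q) where
  involute_eq := by simp
  reverse_mul := ⟨1, by simp [lowerMinor, ← Matrix.fromBlocks_one]⟩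
  conj_mul := ⟨1, by simp [upperMinor, ← Matrix.fromBlocks_one]⟩

lemma mul_pos_of_signs {r s a b c : ℝ} (h1 : 0 < r * a) (h2 : 0 < s * b) (h3 : 0 < a * b * c) :
    0 < s * r * c := by
  -- The product of the three hypotheses, in which $a$ and $b$ occur squared.
  have h4 : 0 < (a * b) ^ 2 * (s * r * c) := by
    have := mul_pos (mul_pos h1 h2) h3
    linarith [this, show r * a * (s * b) * (a * b * c) = (a * b) ^ 2 * (s * r * c) by ring]
  exact pos_of_mul_pos_right h4 (sq_nonneg _)

lemma HasSigns.mul {S T : Lipschitz p q} (hS : HasSigns S) (hT : HasSigns T) :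
    HasSigns (S * T) where
  involute_eq := by
    rw [Subgroup.coe_mul, Units.val_mul, map_mul, hS.involute_eq, hT.involute_eq, map_mul,
      Units.val_mul, Matrix.det_mul, smul_mul_smul_comm]
  reverse_mul := by
    obtain ⟨r, h1, h2⟩ := hS.reverse_mul
    obtain ⟨s, h3, h4⟩ := hT.reverse_mul
    refine ⟨s * r, ?_, ?_⟩
    · rw [Subgroup.coe_mul, Units.val_mul, rev_mul_mul, h1, mul_assoc, Algebra.left_comm, h3,
        ← map_mul, mul_comm]
    · rw [map_mul]
      exact mul_pos_of_signs h2 h4 (lowerMinor_mul_pos (adMatrix_mem_O S) (adMatrix_mem_O T))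
  conj_mul := by
    obtain ⟨r, h1, h2⟩ := hS.conj_mul
    obtain ⟨s, h3, h4⟩ := hT.conj_mul
    refine ⟨s * r, ?_, ?_⟩
    · rw [Subgroup.coe_mul, Units.val_mul, reverse.map_mul, map_mul, mul_assoc,
        ← mul_assoc (involute (reverse (S : (Cl p q)ˣ).val)), h1, Algebra.left_comm, h3,
        ← map_mul, mul_comm]
    · rw [map_mul]
      exact mul_pos_of_signs h2 h4 (upperMinor_mul_pos (adMatrix_mem_O S) (adMatrix_mem_O T))

lemma HasSigns.lipVec {v : Idx p q → ℝ} (hv : Q p q v ≠ 0) : HasSigns (lipVec v hv) := by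
  have h : ((SpinCover.lipVec v hv : Lipschitz p q) : (Cl p q)ˣ).val = ι (Q p q) v := rfl
  refine ⟨?_, ⟨Q p q v, ?_, ?_⟩, ⟨-Q p q v, ?_, ?_⟩⟩
  · rw [adMatrix_lipVec, det_reflMatrix hv, h, involute_ι, neg_one_smul]
  · rw [h, reverse_ι, ι_sq_scalar]
  · rw [adMatrix_lipVec]; exact lowerMinor_reflMatrix_pos hv
  · rw [h, reverse_ι, involute_ι, neg_mul, ι_sq_scalar, map_neg]
  · rw [adMatrix_lipVec]; exact upperMinor_reflMatrix_neg hv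

lemma exists_eq_smul_of_adMatrix_eq {S T : Lipschitz p q} (h : adMatrix p q S = adMatrix p q T) :
    ∃ c : ℝ, c ≠ 0 ∧ (S : (Cl p q)ˣ).val = c • (T : (Cl p q)ˣ).val := by
  obtain ⟨c, hc⟩ := exists_eq_algebraMap_of_adMatrix_eq_one (T := S * T⁻¹)
    (by rw [map_mul, map_inv, h, mul_inv_cancel])
  have h1 : (S : (Cl p q)ˣ).val = c • (T : (Cl p q)ˣ).val := by
    rw [Algebra.smul_def, ← hc, ← Units.val_mul, ← Subgroup.coe_mul, inv_mul_cancel_right]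
  refine ⟨c, fun h0 => (S : (Cl p q)ˣ).ne_zero ?_, h1⟩
  rw [h1, h0, zero_smul]

/-- Equal actions differ by a real factor $c\neq0$, which multiplies both norms by $c^2>0$ and
leaves the parity alone. -/
lemma HasSigns.of_adMatrix_eq {S T : Lipschitz p q} (hT : HasSigns T)
    (h : adMatrix p q S = adMatrix p q T) : HasSigns S := by
  obtain ⟨c, hc, hST⟩ := exists_eq_smul_of_adMatrix_eq h
  have hc2 : 0 < c * c := mul_self_pos.mpr hc
  obtain ⟨h1, ⟨r, h2, h3⟩, ⟨s, h4, h5⟩⟩ := hT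
  refine ⟨?_, ⟨c * c * r, ?_, ?_⟩, ⟨c * c * s, ?_, ?_⟩⟩
  · rw [h, hST, map_smul, h1, smul_comm]
  · rw [hST, map_smul, smul_mul_smul_comm, h2, map_mul, Algebra.smul_def]
  · rw [h, mul_assoc]; positivity
  · rw [hST, map_smul, map_smul, smul_mul_smul_comm, h4, map_mul, Algebra.smul_def]
  · rw [h, mul_assoc]; positivity

/-! ### Generation of `O(p,q)` by reflections -/

lemma reflMatrix_sub_mulVec {x y : Idx p q → ℝ} (hxy : Q p q y = Q p q x)
    (h : Q p q (y - x) ≠ 0) : reflMatrix (y - x) *ᵥ x = y := by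
  have h1 : QuadraticMap.polar (Q p q) x (y - x) = -Q p q (y - x) := by
    have := QuadraticMap.map_add (Q p q) x (y - x)
    rw [add_sub_cancel, hxy] at this
    linarith
  rw [reflMatrix_mulVec, h1, neg_div, div_self h, neg_one_smul]
  abel

lemma reflMatrix_self_mulVec {x : Idx p q → ℝ} (h : Q p q x ≠ 0) :
    reflMatrix x *ᵥ x = -x := by
  rw [reflMatrix_mulVec, QuadraticMap.polar_self, nsmul_eq_mul, mul_div_assoc, div_self h]
  module

lemma reflMatrix_mulVec_of_polar_eq_zero {v z : Idx p q → ℝ}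
    (h : QuadraticMap.polar (Q p q) z v = 0) : reflMatrix v *ᵥ z = z := by
  simp [reflMatrix_mulVec, h]

/-- If $y-x$ is anisotropic, the reflection along it suffices. Otherwise $x\mapsto-x\mapsto y$ by
the reflections along $x$ and $y+x$. All these directions lie in the span of $x$ and $y$, hence
vectors orthogonal to both stay fixed. -/
lemma exists_hasSigns_mulVec_eq {x y : Idx p q → ℝ} (hx : Q p q x ≠ 0) (hxy : Q p q y = Q p q x) :
    ∃ R : Lipschitz p q, HasSigns R ∧ (adMatrix p q R).val *ᵥ x = y ∧
      ∀ z, QuadraticMap.polar (Q p q) z x = 0 → QuadraticMap.polar (Q p q) z y = 0 →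
        (adMatrix p q R).val *ᵥ z = z := by
  by_cases h : Q p q (y - x) = 0
  -- Parallelogram law: $Q(y+x)+Q(y-x)=4Q(x)\neq0$.
  · have hp : Q p q (y - -x) ≠ 0 := by
      have h1 := QuadraticMap.map_add (Q p q) y x
      have h2 := QuadraticMap.map_add (Q p q) y (-x)
      rw [← sub_eq_add_neg, h, QuadraticMap.map_neg, QuadraticMap.polar_neg_right] at h2
      rw [sub_neg_eq_add, h1]
      intro h3
      exact hx (by linarith)
    refine ⟨lipVec _ hp * lipVec x hx, (HasSigns.lipVec hp).mul (HasSigns.lipVec hx), ?_, ?_⟩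
    · rw [map_mul, Units.val_mul, adMatrix_lipVec, adMatrix_lipVec, ← Matrix.mulVec_mulVec,
        reflMatrix_self_mulVec hx, reflMatrix_sub_mulVec (by rw [hxy, QuadraticMap.map_neg]) hp]
    · intro z hzx hzy
      rw [map_mul, Units.val_mul, adMatrix_lipVec, adMatrix_lipVec, ← Matrix.mulVec_mulVec,
        reflMatrix_mulVec_of_polar_eq_zero hzx, reflMatrix_mulVec_of_polar_eq_zero]
      rw [sub_neg_eq_add, QuadraticMap.polar_add_right, hzx, hzy, add_zero]
  · refine ⟨lipVec _ h, HasSigns.lipVec h, ?_, fun z hzx hzy => ?_⟩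
    · rw [adMatrix_lipVec, reflMatrix_sub_mulVec hxy h]
    · rw [adMatrix_lipVec, reflMatrix_mulVec_of_polar_eq_zero]
      rw [QuadraticMap.polar_sub_right, hzx, hzy, sub_zero]

/-- Cartan–Dieudonné by induction on the basis vectors that $A$ may move: if $R$ sends $e_a$ to
$Ae_a$, then $R^{-1}A$ fixes $e_a$ and every basis vector already fixed. -/
lemma exists_hasSigns_adMatrix_eq_of_fix (S : Finset (Idx p q)) :
    ∀ A ∈ O p q, (∀ i ∉ S, A.val *ᵥ Pi.single i 1 = Pi.single i 1) →
      ∃ T : Lipschitz p q, HasSigns T ∧ adMatrix p q T = A := by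
  induction S using Finset.induction_on with
  | empty =>
    refine fun A _ h => ⟨1, HasSigns.one, ?_⟩
    rw [map_one]
    refine Units.ext (Matrix.ext_of_mulVec_single fun i => ?_)
    rw [h i (Finset.notMem_empty i), Units.val_one, Matrix.one_mulVec]
  | insert a S ha ih =>
    intro A hA h
    obtain ⟨R, hR, hRa, hRf⟩ := exists_hasSigns_mulVec_eq (x := Pi.single a 1)
      (y := A.val *ᵥ Pi.single a 1) (by rw [Q_single]; exact sgn_ne_zero a) (mem_O_iff.mp hA _)
    have hinv : ∀ {x y}, (adMatrix p q R).val *ᵥ x = y → ((adMatrix p q R)⁻¹).val *ᵥ y = x := by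
      rintro x _ rfl
      rw [Matrix.mulVec_mulVec, ← Units.val_mul, inv_mul_cancel, Units.val_one, Matrix.one_mulVec]
    obtain ⟨T, hT, hTA⟩ := ih ((adMatrix p q R)⁻¹ * A)
      ((O p q).mul_mem ((O p q).inv_mem (adMatrix_mem_O R)) hA) fun i hi => by
        rw [Units.val_mul, ← Matrix.mulVec_mulVec]
        by_cases hia : i = a
        · subst hia
          exact hinv hRa
        · have hi' := h i (by simp [hi, hia])
          have horth : QuadraticMap.polar (Q p q) (Pi.single i 1) (Pi.single a 1) = 0 := by
            rw [polar_eq_dotProduct]; simp [eta, hia]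
          rw [hi']
          refine hinv (hRf _ horth ?_)
          -- As $Ae_i=e_i$ and $A$ is an isometry, $e_i$ is orthogonal to $Ae_a$ because it is
          -- orthogonal to $e_a$.
          rw [← horth]
          conv_lhs => rw [← hi']
          simp only [QuadraticMap.polar, ← Matrix.mulVec_add, mem_O_iff.mp hA]
    exact ⟨R * T, hR.mul hT, by rw [map_mul, hTA, mul_inv_cancel_left]⟩

lemma exists_hasSigns_adMatrix_eq (hA : A ∈ O p q) :
    ∃ T : Lipschitz p q, HasSigns T ∧ adMatrix p q T = A :=
  exists_hasSigns_adMatrix_eq_of_fix Finset.univ A hA (by simp)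

lemma hasSigns (T : Lipschitz p q) : HasSigns T := by
  obtain ⟨S, hS, hST⟩ := exists_hasSigns_adMatrix_eq (adMatrix_mem_O T)
  exact hS.of_adMatrix_eq hST.symm

end

/-! ### The coverings -/

section

variable {p q : ℕ}

lemma involute_eq_self_iff (T : Lipschitz p q) :
    involute (T : (Cl p q)ˣ).val = (T : (Cl p q)ˣ).val ↔ (adMatrix p q T).val.det = 1 := by
  rw [(hasSigns T).involute_eq]
  refine ⟨fun h => ?_, fun h => by rw [h, one_smul]⟩
  exact smul_left_injective ℝ (T : (Cl p q)ˣ).ne_zero (h.trans (one_smul ℝ _).symm)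

lemma det_eq_one_or_neg_one {A : GL (Idx p q) ℝ} (hA : A ∈ O p q) :
    A.val.det = 1 ∨ A.val.det = -1 := by
  have h : A.valᵀ * eta p q * A.val = eta p q := hA
  have h1 := congrArg Matrix.det h
  have h2 : (eta p q).det ≠ 0 := fun h0 => by
    simpa [h0] using congrArg Matrix.det (eta_mul_eta p q)
  rw [Matrix.det_mul, Matrix.det_mul, Matrix.det_transpose] at h1
  refine mul_self_eq_one_iff.mp (mul_right_cancel₀ h2 ?_)
  linarith

/-- The two norms differ by the determinant, which is $\pm1$; so $\mathrm{Pin}(p,q)$ may be defined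
by either, and on $\mathrm{Spin}(p,q)$ they agree. -/
lemma conj_mul_self (T : Lipschitz p q) :
    involute (reverse (T : (Cl p q)ˣ).val) * (T : (Cl p q)ˣ).val =
      (adMatrix p q T).val.det • (reverse (T : (Cl p q)ˣ).val * (T : (Cl p q)ˣ).val) := by
  rw [← reverse_involute, (hasSigns T).involute_eq, map_smul, smul_mul_assoc]

lemma algebraMap_eq_one_iff {r : ℝ} : algebraMap ℝ (Cl p q) r = 1 ↔ r = 1 := by
  rw [← map_one (algebraMap ℝ (Cl p q)), (algebraMap ℝ (Cl p q)).injective.eq_iff]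

lemma algebraMap_eq_neg_one_iff {r : ℝ} : algebraMap ℝ (Cl p q) r = -1 ↔ r = -1 := by
  rw [← map_one (algebraMap ℝ (Cl p q)), ← map_neg, (algebraMap ℝ (Cl p q)).injective.eq_iff]

lemma eq_one_iff_one_le {r m : ℝ} (hr : r = 1 ∨ r = -1) (hm : 1 ≤ m * m) (h : 0 < r * m) :
    r = 1 ↔ 1 ≤ m := by
  rcases hr with rfl | rfl
  · simp only [true_iff]; nlinarith
  · refine ⟨fun h => by norm_num at h, fun h => by linarith⟩

lemma mem_revOne_iff {T : Lipschitz p q} (hT : (T : (Cl p q)ˣ) ∈ revPM p q) :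
    (T : (Cl p q)ˣ) ∈ revOne p q ↔ 1 ≤ lowerMinor (adMatrix p q T).val := by
  obtain ⟨r, h1, h2⟩ := (hasSigns T).reverse_mul
  change reverse (T : (Cl p q)ˣ).val * (T : (Cl p q)ˣ).val = 1 ∨
    reverse (T : (Cl p q)ˣ).val * (T : (Cl p q)ˣ).val = -1 at hT
  change reverse (T : (Cl p q)ˣ).val * (T : (Cl p q)ˣ).val = 1 ↔ _
  rw [h1, algebraMap_eq_one_iff, algebraMap_eq_neg_one_iff] at hT
  rw [h1, algebraMap_eq_one_iff]
  exact eq_one_iff_one_le hT (one_le_lowerMinor_sq (adMatrix_mem_O T)) h2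

lemma mem_revPM_iff_conj (T : Lipschitz p q) : (T : (Cl p q)ˣ) ∈ revPM p q ↔
    involute (reverse (T : (Cl p q)ˣ).val) * (T : (Cl p q)ˣ).val = 1 ∨
    involute (reverse (T : (Cl p q)ˣ).val) * (T : (Cl p q)ˣ).val = -1 := by
  change reverse (T : (Cl p q)ˣ).val * (T : (Cl p q)ˣ).val = 1 ∨
    reverse (T : (Cl p q)ˣ).val * (T : (Cl p q)ˣ).val = -1 ↔ _
  rw [conj_mul_self]
  rcases det_eq_one_or_neg_one (adMatrix_mem_O T) with h | h
  · rw [h, one_smul]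
  · rw [h, neg_one_smul, neg_inj, neg_eq_iff_eq_neg, or_comm]

lemma mem_conjOne_iff {T : Lipschitz p q} (hT : (T : (Cl p q)ˣ) ∈ revPM p q) :
    (T : (Cl p q)ˣ) ∈ conjOne p q ↔ 1 ≤ upperMinor (adMatrix p q T).val := by
  obtain ⟨r, h1, h2⟩ := (hasSigns T).conj_mul
  rw [mem_revPM_iff_conj] at hT
  change involute (reverse (T : (Cl p q)ˣ).val) * (T : (Cl p q)ˣ).val = 1 ↔ _
  rw [h1, algebraMap_eq_one_iff, algebraMap_eq_neg_one_iff] at hT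
  rw [h1, algebraMap_eq_one_iff]
  exact eq_one_iff_one_le hT (one_le_upperMinor_sq (adMatrix_mem_O T)) h2

lemma mem_conjOne_iff_mem_revOne {T : Lipschitz p q} (hT : (adMatrix p q T).val.det = 1) :
    (T : (Cl p q)ˣ) ∈ conjOne p q ↔ (T : (Cl p q)ˣ) ∈ revOne p q := by
  change involute (reverse (T : (Cl p q)ˣ).val) * (T : (Cl p q)ˣ).val = 1 ↔
    reverse (T : (Cl p q)ˣ).val * (T : (Cl p q)ˣ).val = 1
  rw [conj_mul_self, hT, one_smul]

lemma revOne_le_revPM : revOne p q ≤ revPM p q := fun _ h => Or.inl h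

lemma mem_gammaPlus_iff {T : (Cl p q)ˣ} :
    T ∈ GammaPlus p q ↔ T ∈ Lipschitz p q ∧ involute T.val = T.val := by
  change T.val ∈ evenOdd (Q p q) 0 ∧ _ ↔ _
  rw [mem_even_iff, and_comm]
  refine and_congr_left fun h => forall₂_congr fun x _ => ?_
  rw [twistedAd_apply, h]

lemma mem_SO_iff {A : GL (Idx p q) ℝ} : A ∈ SO p q ↔ A ∈ O p q ∧ A.val.det = 1 := by
  rw [SO, Subgroup.mem_inf, MonoidHom.mem_ker, Units.ext_iff]
  rfl

/-- A non-zero scalar as an element of the Lipschitz group. -/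
def lipScalar (p q : ℕ) (c : ℝ) (hc : c ≠ 0) : Lipschitz p q :=
  ⟨Units.map (algebraMap ℝ (Cl p q)).toMonoidHom (Units.mk0 c hc), fun x hx => by
    rw [twistedAd_apply, Units.coe_map, Units.coe_map_inv]
    simp only [Units.val_mk0, RingHom.toMonoidHom_eq_coe, MonoidHom.coe_coe,
      AlgHom.commutes, Units.val_inv_eq_inv_val]
    rw [← Algebra.commutes, ← mul_assoc, ← map_mul, inv_mul_cancel₀ hc, map_one, one_mul]
    exact hx⟩

lemma coe_lipScalar {c : ℝ} (hc : c ≠ 0) :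
    (lipScalar p q c hc : (Cl p q)ˣ).val = algebraMap ℝ _ c := rfl

lemma adMatrix_eq_one_of_algebraMap {T : Lipschitz p q} {c : ℝ}
    (h : (T : (Cl p q)ˣ).val = algebraMap ℝ _ c) : adMatrix p q T = 1 := by
  refine adMatrix_eq_of_mulVec fun x => ?_
  rw [Units.val_one, Matrix.one_mulVec, twistedAd_apply, h, AlgHom.commutes, Algebra.commutes,
    mul_assoc, ← h, Units.mul_inv, mul_one]

lemma exists_mem_revPM_adMatrix_eq {A : GL (Idx p q) ℝ} (hA : A ∈ O p q) :
    ∃ T : Lipschitz p q, (T : (Cl p q)ˣ) ∈ revPM p q ∧ adMatrix p q T = A := by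
  obtain ⟨T, ⟨_, ⟨r, h1, h2⟩, _⟩, rfl⟩ := exists_hasSigns_adMatrix_eq hA
  have hr : r ≠ 0 := fun h => by simp [h] at h2
  -- Scaling $T$ by $c=|r|^{-1/2}$ turns its norm $r$ into $c^2r=\pm1$ without changing its action.
  have hc : (√|r|)⁻¹ ≠ 0 := inv_ne_zero (Real.sqrt_ne_zero'.mpr (abs_pos.mpr hr))
  refine ⟨lipScalar p q _ hc * T, ?_, by
    rw [map_mul, adMatrix_eq_one_of_algebraMap (coe_lipScalar hc), one_mul]⟩
  have h3 : reverse (lipScalar p q _ hc * T : (Cl p q)ˣ).val *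
      (lipScalar p q _ hc * T : (Cl p q)ˣ).val =
      algebraMap ℝ (Cl p q) ((√|r|)⁻¹ * (√|r|)⁻¹ * r) := by
    rw [Units.val_mul, coe_lipScalar, ← Algebra.smul_def, map_smul, smul_mul_smul_comm, h1,
      Algebra.smul_def, ← map_mul]
  have h4 : (√|r|)⁻¹ * (√|r|)⁻¹ * r = r / |r| := by
    rw [← mul_inv, Real.mul_self_sqrt (abs_nonneg r), inv_mul_eq_div]
  rw [h4] at h3
  rcases lt_or_gt_of_ne hr with h | h
  · right
    refine h3.trans ?_
    rw [abs_of_neg h, div_neg, div_self hr, map_neg, map_one]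
  · left
    refine h3.trans ?_
    rw [abs_of_pos h, div_self hr, map_one]

lemma coe_eq_one_or_neg_one {T : Lipschitz p q} (hT : (T : (Cl p q)ˣ) ∈ revPM p q)
    (h : adMatrix p q T = 1) : (T : (Cl p q)ˣ) = 1 ∨ (T : (Cl p q)ˣ) = -1 := by
  obtain ⟨c, hc⟩ := exists_eq_algebraMap_of_adMatrix_eq_one h
  change reverse (T : (Cl p q)ˣ).val * (T : (Cl p q)ˣ).val = 1 ∨
    reverse (T : (Cl p q)ˣ).val * (T : (Cl p q)ˣ).val = -1 at hT
  rw [hc, reverse.commutes, ← map_mul, algebraMap_eq_one_iff, algebraMap_eq_neg_one_iff] at hT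
  rw [Units.ext_iff, Units.ext_iff, hc, Units.val_neg, Units.val_one, algebraMap_eq_one_iff,
    algebraMap_eq_neg_one_iff]
  exact mul_self_eq_one_iff.mp (hT.resolve_right fun h => by nlinarith)

lemma of_eq_one_or_neg_one {T : (Cl p q)ˣ} (hT : T = 1 ∨ T = -1) :
    T ∈ Lipschitz p q ∧ T ∈ revPM p q ∧ ∃ c : ℝ, T.val = algebraMap ℝ _ c := by
  rcases hT with rfl | rfl
  · exact ⟨one_mem _, one_mem _, 1, by rw [map_one, Units.val_one]⟩
  · refine ⟨fun x hx => ?_, Or.inl ?_, -1, by rw [map_neg, map_one, Units.val_neg, Units.val_one]⟩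
    · rw [twistedAd_apply, inv_neg_one]
      simpa using hx
    · rw [Units.val_neg, Units.val_one, map_neg, reverse.map_one, neg_mul_neg, one_mul]

/-- The last hypothesis says that $G$ is the whole preimage of $H$ in $\mathrm{Pin}(p,q)$. It
therefore contains $\pm e$ and every normalised lift of an element of $H$. -/
lemma twistedAdCovers_of_le_pin {G : Subgroup (Cl p q)ˣ} {H : Subgroup (GL (Idx p q) ℝ)}
    (hG : G ≤ Pin p q) (hH : H ≤ O p q)
    (h : ∀ T : Lipschitz p q, (T : (Cl p q)ˣ) ∈ revPM p q →
      ((T : (Cl p q)ˣ) ∈ G ↔ adMatrix p q T ∈ H)) : TwistedAdCovers G H := by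
  have hL : G ≤ Lipschitz p q := hG.trans inf_le_left
  have hR : ∀ T ∈ G, T ∈ revPM p q := fun T hT => (Subgroup.mem_inf.mp (hG hT)).2
  obtain ⟨f, hf⟩ : ∃ f : G →* H,
      ∀ T : G, (f T : GL (Idx p q) ℝ) = adMatrix p q ⟨T, hL T.2⟩ :=
    ⟨((adMatrix p q).comp (Subgroup.inclusion hL)).codRestrict H fun T =>
      (h (Subgroup.inclusion hL T) (hR _ T.2)).mp T.2, fun _ => rfl⟩
  refine ⟨f, fun T a => ?_, fun A => ?_, ?_⟩
  · rw [hf]; exact twistedAd_e ⟨T, hL T.2⟩ a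
  · obtain ⟨T, hT, hTA⟩ := exists_mem_revPM_adMatrix_eq (hH A.2)
    exact ⟨⟨T, (h T hT).mpr (hTA ▸ A.2)⟩, Subtype.ext ((hf _).trans hTA)⟩
  · ext T
    simp only [Set.mem_image, SetLike.mem_coe, MonoidHom.mem_ker, Set.mem_insert_iff,
      Set.mem_singleton_iff]
    constructor
    · rintro ⟨T, hT, rfl⟩
      obtain ⟨S, hS⟩ : ∃ S : Lipschitz p q, S = ⟨T, hL T.2⟩ := ⟨_, rfl⟩
      have hST : (S : (Cl p q)ˣ) = T := by rw [hS]
      have hS1 : adMatrix p q S = 1 := by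
        rw [hS, ← hf, hT]
        exact Subgroup.coe_one H
      rw [← hST]
      exact coe_eq_one_or_neg_one (by rw [hST]; exact hR _ T.2) hS1
    · intro hT
      obtain ⟨hTL, hTP, c, hc⟩ := of_eq_one_or_neg_one hT
      have hTA : adMatrix p q ⟨T, hTL⟩ = 1 := adMatrix_eq_one_of_algebraMap (T := ⟨T, hTL⟩) hc
      have hTG : T ∈ G := (h ⟨T, hTL⟩ hTP).mpr (by rw [hTA]; exact one_mem _)
      refine ⟨⟨T, hTG⟩, Subtype.ext ?_, rfl⟩
      rw [hf, hTA, Subgroup.coe_one]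

lemma mem_spin_iff {T : Lipschitz p q} (hT : (T : (Cl p q)ˣ) ∈ revPM p q) :
    (T : (Cl p q)ˣ) ∈ Spin p q ↔ adMatrix p q T ∈ SO p q := by
  rw [mem_SO_iff, ← involute_eq_self_iff, Spin, Subgroup.mem_inf, mem_gammaPlus_iff]
  simp [hT, adMatrix_mem_O]

end

end SpinCover

end

theorem theorem6p1 (p q : ℕ) :
    SpinCover.TwistedAdCovers (SpinCover.Pin p q) (SpinCover.O p q) ∧
    SpinCover.TwistedAdCovers (SpinCover.Spin p q) (SpinCover.SO p q) ∧
    SpinCover.TwistedAdCovers (SpinCover.SpinPlus p q) (SpinCover.SOPlus p q) ∧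
    SpinCover.TwistedAdCovers (SpinCover.PinPlus p q) (SpinCover.OPlus p q) ∧
    SpinCover.TwistedAdCovers (SpinCover.PinMinus p q) (SpinCover.OMinus p q) := by
  open SpinCover in
  have hΓ : GammaPlus p q ≤ Lipschitz p q := fun T hT => (mem_gammaPlus_iff.mp hT).1
  refine ⟨twistedAdCovers_of_le_pin le_rfl le_rfl fun T hT => ?_,
    twistedAdCovers_of_le_pin (inf_le_inf_right _ hΓ) inf_le_left fun T hT => mem_spin_iff hT,
    twistedAdCovers_of_le_pin (inf_le_inf hΓ revOne_le_revPM) (inf_le_left.trans inf_le_left)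
      fun T hT => ?_,
    twistedAdCovers_of_le_pin (fun T hT => ⟨hT.1, (mem_revPM_iff_conj ⟨T, hT.1⟩).mpr (.inl hT.2)⟩)
      (fun A hA => hA.1) fun T hT => ?_,
    twistedAdCovers_of_le_pin (inf_le_inf_left _ revOne_le_revPM) (fun A hA => hA.1)
      fun T hT => ?_⟩
  · exact iff_of_true ⟨T.2, hT⟩ (adMatrix_mem_O T)
  · have h1 : (T : (Cl p q)ˣ) ∈ SpinPlus p q ↔
        (T : (Cl p q)ˣ) ∈ Spin p q ∧ (T : (Cl p q)ˣ) ∈ revOne p q :=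
      ⟨fun h => ⟨⟨h.1, hT⟩, h.2⟩, fun h => ⟨h.1.1, h.2⟩⟩
    rw [h1, mem_spin_iff hT, SOPlus, Subgroup.mem_inf]
    refine and_congr_right fun h => ?_
    -- $\mathrm{Spin}_+$ is cut out by the reversion, whose sign goes with the lower minor, but
    -- $\mathrm{SO}_+$ by the upper one; determinant $1$ makes the two norms equal.
    rw [← mem_conjOne_iff_mem_revOne (mem_SO_iff.mp h).2, mem_conjOne_iff hT]
    exact (and_iff_right (adMatrix_mem_O T)).symm
  · exact (and_iff_right T.2).trans
      ((mem_conjOne_iff hT).trans (and_iff_right (adMatrix_mem_O T)).symm)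
  · exact (and_iff_right T.2).trans
      ((mem_revOne_iff hT).trans (and_iff_right (adMatrix_mem_O T)).symm)
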